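/- Let $S$ be a quantum system with finite-dimensional Hilbert space $\mathcal H_S$, let $\rho$ be a state on $S$ (a positive semidefinite operator of trace $1$, not necessarily of full rank), and let $X_1^S,\dots,X_N^S$ be Hermitian operators on $\mathcal H_S$. For $t\in\mathbb R^N$ put $U_t=e^{-i\sum_k t_kX_k^S}$ and $\rho_t=U_t\rho U_t^{-1}$. The SLD quantum Fisher information matrix $\hat F_\rho(\{X_n^S\})$ is the $N\times N$ matrix with entries $$\bigl(\hat F_\rho(\{X_n^S\})\bigr)_{kl}=\mathrm{tr}\Bigl[\frac{\partial\rho_t}{\partial t_k}\,\mathbb J_{\rho_t}^{-1}\Bigl(\frac{\partial\rho_t}{\partial t_l}\Bigr)\Bigr]\Big|_{t=0},\qquad \mathbb J_\rho(L)=\tfrac12(\rho L+L\rho),$$ where $\mathbb J_{\rho}^{-1}(D)$ denotes any solution $L$ of $\mathbb J_{\rho}(L)=D$ (for the derivatives above a solution exists, and the trace does not depend on its choice). For a state $\sigma$ and Hermitian operators $Y_1,\dots,Y_N$ on a finite-dimensional Hilbert space, let $\langle Y\rangle_\sigma=\mathrm{Tr}[\sigma Y]$ and let $\hat V_\sigma(\{Y_n\})$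 be the covariance matrix $$\bigl(\hat V_\sigma(\{Y_n\})\bigr)_{kl}=\tfrac12\bigl\langle (Y_k-\langle Y_k\rangle_\sigma)(Y_l-\langle Y_l\rangle_\sigma)+(Y_l-\langle Y_l\rangle_\sigma)(Y_k-\langle Y_k\rangle_\sigma)\bigr\rangle_\sigma ,$$ and write $\hat V_{|\psi\rangle}=\hat V_{|\psi\rangle\langle\psi|}$. Then $$\hat F_\rho(\{X_n^S\})=4\min_{|\psi_\rho\rangle,\{X_n^R\}}\hat V_{|\psi_\rho\rangle}(\{X_n^S+X_n^R\}),$$ where $|\psi_\rho\rangle\in\mathcal H_S\otimes\mathcal H_R$ runs over all purifications of $\rho$ (that is, $\mathrm{Tr}_R|\psi_\rho\rangle\langle\psi_\rho|=\rho$) with an auxiliary system $R$ of arbitrary finite dimension, $\{X_n^R\}_{n=1}^N$ runs over all families of Hermitian operators on $\mathcal H_R$, and $X_n^S+X_n^R$ means $X_n^S\otimes 1+1\otimes X_n^R$. The minimum is with respect to matrix inequality ($A\le B$ iff $B-A$ is positive semidefinite): the set of these covariance matrices has a least element, and four times this element is $\hat F_\rho(\{X_n^S\})$. -/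

import Mathlib

open scoped MatrixOrder ComplexOrder Kronecker

namespace QuantumFisher

/-- A quantum state (density operator) on the finite-dimensional Hilbert space `ℂ^S`. -/
structure IsState {S : Type*} [Fintype S] (ρ : Matrix S S ℂ) : Prop where
  posSemidef : ρ.PosSemidef
  trace_eq_one : ρ.trace = 1

/-- The superoperator `𝕁_ρ(L) = (ρ L + L ρ) / 2`, i.e. `f(𝕃_ρ ℝ_ρ⁻¹) ℝ_ρ` for the function
`f(x) = (1 + x) / 2` that gives the symmetric logarithmic derivative. -/
noncomputable def jordan {S : Type*} [Fintype S] (ρ L : Matrix S S ℂ) : Matrix S S ℂ :=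
  (1 / 2 : ℂ) • (ρ * L + L * ρ)

open Classical in
/-- A symmetric logarithmic derivative: a solution `L` of `𝕁_ρ(L) = D`, written `𝕁_ρ⁻¹(D)`.
For invertible states the solution exists and is unique. For singular states `𝕁_ρ` is not
injective, and any solution may be taken: by `trace_mul_eq_of_jordan_eq` the Fisher information
does not depend on it, and by `exists_jordan_eq` there is a solution for every tangent vector
`-i[X, ρ]` of a unitary orbit. (The value is `0` if there is no solution.) -/
noncomputable def sld {S : Type*} [Fintype S] (ρ D : Matrix S S ℂ) : Matrix S S ℂ :=
  if h : ∃ L : Matrix S S ℂ, jordan ρ L = D then h.choose else 0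

/-- The pairing `tr[D 𝕁_ρ⁻¹(E)]` does not depend on the solution chosen. -/
theorem trace_mul_eq_of_jordan_eq {S : Type*} [Fintype S] {ρ D E K L L' : Matrix S S ℂ}
    (hD : jordan ρ K = D) (hL : jordan ρ L = E) (hL' : jordan ρ L' = E) :
    (D * L).trace = (D * L').trace := by
  have key : ∀ M : Matrix S S ℂ, (jordan ρ K * M).trace = (K * jordan ρ M).trace := by
    intro M
    simp only [jordan, Matrix.smul_mul, Matrix.mul_smul, Matrix.trace_smul, Matrix.add_mul,
      Matrix.mul_add, Matrix.trace_add]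
    rw [Matrix.mul_assoc ρ K M, Matrix.trace_mul_comm ρ (K * M), Matrix.mul_assoc K M ρ,
      Matrix.mul_assoc K ρ M, add_comm]
  rw [← hD, key, key, hL, hL']

/-- Symmetric logarithmic derivatives exist along unitary orbits. -/
theorem exists_jordan_eq {S : Type*} [Fintype S] [DecidableEq S] {ρ : Matrix S S ℂ}
    (hρ : ρ.PosSemidef) (X : Matrix S S ℂ) :
    ∃ L : Matrix S S ℂ, jordan ρ L = (-Complex.I) • (X * ρ - ρ * X) := by
  obtain ⟨U, p, h1, h2, hs, hp0⟩ : ∃ (U : Matrix S S ℂ) (p : S → ℝ), star U * U = 1 ∧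
      U * star U = 1 ∧ ρ = U * Matrix.diagonal (fun i => (p i : ℂ)) * star U ∧ ∀ i, 0 ≤ p i :=
    ⟨_, _, Unitary.coe_star_mul_self hρ.1.eigenvectorUnitary,
      Unitary.coe_mul_star_self hρ.1.eigenvectorUnitary,
      by simpa [Unitary.conjStarAlgAut_apply, Function.comp_def] using hρ.1.spectral_theorem,
      hρ.eigenvalues_nonneg⟩
  have diag : ∀ Y : Matrix S S ℂ, ∃ M : Matrix S S ℂ,
      jordan (Matrix.diagonal (fun i => (p i : ℂ))) M
        = (-Complex.I) • (Y * Matrix.diagonal (fun i => (p i : ℂ)) - Matrix.diagonal (fun i => (p i : ℂ)) * Y) := by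
    intro Y
    refine ⟨Matrix.of fun i j => 2 * (-Complex.I) * Y i j * ((p j : ℂ) - p i) / ((p i : ℂ) + p j), ?_⟩
    ext i j
    simp only [jordan, Matrix.smul_apply, Matrix.add_apply, Matrix.sub_apply,
      Matrix.diagonal_mul, Matrix.mul_diagonal, Matrix.of_apply, smul_eq_mul]
    by_cases h : (p i : ℂ) + p j = 0
    · have h' : p i + p j = 0 := by exact_mod_cast h
      have hi0 : p i = 0 := by linarith [hp0 i, hp0 j]
      have hj0 : p j = 0 := by linarith [hp0 i, hp0 j]
      simp [hi0, hj0]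
    · field_simp
      ring
  obtain ⟨M, hM⟩ := diag (star U * X * U)
  refine ⟨U * M * star U, ?_⟩
  have e1 : jordan ρ (U * M * star U) = U * jordan (Matrix.diagonal (fun i => (p i : ℂ))) M * star U := by
    rw [hs]
    simp only [jordan, Matrix.mul_smul, Matrix.smul_mul, Matrix.mul_add, Matrix.add_mul]
    congr 2
    · calc _ = U * Matrix.diagonal (fun i => (p i : ℂ)) * (star U * U) * M * star U := by
            simp only [Matrix.mul_assoc]
        _ = _ := by rw [h1]; simp only [Matrix.mul_assoc, Matrix.one_mul]
    · calc _ = U * M * (star U * U) * Matrix.diagonal (fun i => (p i : ℂ)) * star U := by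
            simp only [Matrix.mul_assoc]
        _ = _ := by rw [h1]; simp only [Matrix.mul_assoc, Matrix.one_mul]
  rw [e1, hM, hs]
  simp only [Matrix.mul_smul, Matrix.smul_mul, Matrix.mul_sub, Matrix.sub_mul]
  congr 2
  · calc _ = (U * star U) * X * U * Matrix.diagonal (fun i => (p i : ℂ)) * star U := by
          simp only [Matrix.mul_assoc]
      _ = _ := by rw [h2]; simp only [Matrix.mul_assoc, Matrix.one_mul]
  · calc _ = U * Matrix.diagonal (fun i => (p i : ℂ)) * star U * X * (U * star U) := by
          simp only [Matrix.mul_assoc]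
      _ = _ := by rw [h2]; simp only [Matrix.mul_assoc, Matrix.mul_one]

/-- The partial derivative `∂ρ_t / ∂t_k` of a family of operators `{ρ_t}` with `t ∈ ℝ^N`. -/
noncomputable def partialDeriv {S : Type*} [Fintype S] {N : ℕ}
    (ρ : (Fin N → ℝ) → Matrix S S ℂ) (t : Fin N → ℝ) (k : Fin N) : Matrix S S ℂ :=
  deriv (fun s : ℝ => ρ (Function.update t k s)) (t k)

/-- The SLD quantum Fisher information matrix of a family of states `{ρ_t}` at the point `t`:
`(Ĵ_{ρ_t})_{kl} = tr[(∂ρ_t/∂t_k) 𝕁_{ρ_t}⁻¹ (∂ρ_t/∂t_l)]`. -/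
noncomputable def fisherMatrix {S : Type*} [Fintype S] {N : ℕ}
    (ρ : (Fin N → ℝ) → Matrix S S ℂ) (t : Fin N → ℝ) : Matrix (Fin N) (Fin N) ℂ :=
  Matrix.of fun k l => (partialDeriv ρ t k * sld (ρ t) (partialDeriv ρ t l)).trace

/-- The unitary operators `U_t = exp(-i ∑ₖ tₖ Xₖ)`. -/
noncomputable def unitaryFamily {S : Type*} [Fintype S] [DecidableEq S] {N : ℕ}
    (X : Fin N → Matrix S S ℂ) (t : Fin N → ℝ) : Matrix S S ℂ :=
  NormedSpace.exp ((-Complex.I) • ∑ k, (t k : ℂ) • X k)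

/-- The SLD quantum Fisher information matrix `F̂_ρ({Xₙ})` of a state `ρ` with respect to the
Hermitian operators `X₁, …, X_N`: the Fisher information matrix at `t = 0` of the family
`U_t ρ U_t⁻¹`, where `U_t = exp(-i ∑ₖ tₖ Xₖ)`. -/
noncomputable def qFisherMatrix {S : Type*} [Fintype S] [DecidableEq S] {N : ℕ}
    (ρ : Matrix S S ℂ) (X : Fin N → Matrix S S ℂ) : Matrix (Fin N) (Fin N) ℂ :=
  fisherMatrix (fun t => unitaryFamily X t * ρ * (unitaryFamily X t)⁻¹) 0

/-- The expected value `⟨Y⟩_σ = Tr[σ Y]`. -/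
noncomputable def expect {H : Type*} [Fintype H] (σ Y : Matrix H H ℂ) : ℂ :=
  (σ * Y).trace

/-- The operator `X - ⟨X⟩_σ`. -/
noncomputable def centered {H : Type*} [Fintype H] [DecidableEq H] (σ X : Matrix H H ℂ) :
    Matrix H H ℂ :=
  X - expect σ X • (1 : Matrix H H ℂ)

/-- The (symmetrized) covariance matrix `V̂_σ({Xₙ})`. -/
noncomputable def covMatrix {H : Type*} [Fintype H] [DecidableEq H] {N : ℕ}
    (σ : Matrix H H ℂ) (X : Fin N → Matrix H H ℂ) : Matrix (Fin N) (Fin N) ℂ :=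
  Matrix.of fun k l => (1 / 2 : ℂ) *
    expect σ (centered σ (X k) * centered σ (X l) + centered σ (X l) * centered σ (X k))

/-- The operator `|ψ⟩⟨ψ|`. -/
def ketbra {H : Type*} (ψ : H → ℂ) : Matrix H H ℂ :=
  Matrix.vecMulVec ψ (star ψ)

/-- The partial trace over the second factor of `ℂ^S ⊗ ℂ^R = ℂ^(S × R)`. -/
def partialTrace {S R : Type*} [Fintype R] (M : Matrix (S × R) (S × R) ℂ) : Matrix S S ℂ :=
  Matrix.of fun i j => ∑ r, M (i, r) (j, r)

/-- `|ψ⟩` in `ℂ^S ⊗ ℂ^R` is a purification of `ρ`. Such a `ψ` is a unit vector as soon as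
`tr ρ = 1`. -/
def IsPurification {S R : Type*} [Fintype R] (ρ : Matrix S S ℂ) (ψ : S × R → ℂ) : Prop :=
  partialTrace (ketbra ψ) = ρ

/-- The operator `X^S + X^R` on `ℂ^S ⊗ ℂ^R`, i.e. `X^S ⊗ 1 + 1 ⊗ X^R`. -/
def sumOp {S R : Type*} [DecidableEq S] [DecidableEq R] (XS : Matrix S S ℂ) (XR : Matrix R R ℂ) :
    Matrix (S × R) (S × R) ℂ :=
  XS ⊗ₖ (1 : Matrix R R ℂ) + (1 : Matrix S S ℂ) ⊗ₖ XR

/-- The set of all covariance matrices `V̂_{|ψ_ρ⟩}({Xₙ^S + Xₙ^R})`, where `|ψ_ρ⟩` runs over the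
purifications of `ρ` with an auxiliary system `R` of any finite dimension and the `Xₙ^R` run over
the Hermitian operators of `R`. -/
def purifiedCovMatrices {S : Type*} [Fintype S] [DecidableEq S] {N : ℕ}
    (ρ : Matrix S S ℂ) (XS : Fin N → Matrix S S ℂ) : Set (Matrix (Fin N) (Fin N) ℂ) :=
  {V | ∃ (m : ℕ) (ψ : S × Fin m → ℂ) (XR : Fin N → Matrix (Fin m) (Fin m) ℂ),
    IsPurification ρ ψ ∧ (∀ n, (XR n).IsHermitian) ∧
      V = covMatrix (ketbra ψ) (fun n => sumOp (XS n) (XR n))}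

end QuantumFisher

/-!
A vector `|ψ⟩` of `ℂ^S ⊗ ℂ^R` is the same thing as its coefficient matrix `Ψ`, with reduced state
`Ψ Ψᴴ`. Let `Aₖ` be the coefficient matrix of `(Xₖ + Yₖ - ⟨Xₖ + Yₖ⟩)|ψ⟩`, so that the covariance
matrix is `Re tr (Aₖᴴ Aₗ)`, and let `Lₖ` be a Hermitian symmetric logarithmic derivative of
`-i[Xₖ, ρ]`. The auxiliary generators and the mean values drop out of
`Aₖ Ψᴴ - Ψ Aₖᴴ = [Xₖ, ρ]` (`deviation_mul_conjTranspose_sub`). Hence the cross terms between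
`Aₖ` and `(i/2) Lₗ Ψ` are determined by the Fisher information matrix `F`, and completing the square
gives `V = F / 4 + Re tr (Bₖᴴ Bₗ)` with `Bₖ = Aₖ - (i/2) Lₖ Ψ` (`covMatrix_eq_add_symGram`). A Gram
matrix is positive semidefinite, which is the bound `F ≤ 4 V`.

The bound is attained when `Aₖ = (i/2) Lₖ Ψ` for all `k` simultaneously. For the purification
`Ψ = U √P`, where `ρ = U P Uᴴ` is diagonalized with eigenvalues `pᵢ`, this equation for `Yₖ` is
solved by the Hermitian matrix whose transpose has the entries
`-2 √(pᵢ pⱼ) / (pᵢ + pⱼ) (Uᴴ Xₖ U)ᵢⱼ`, also when some of the `pᵢ` vanish (`exists_optimal_square_root`).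
-/

namespace QuantumFisher

open scoped Matrix

/-! ### The Fisher information matrix of a unitary orbit -/

section OrbitDerivative

-- This norm induces the entrywise topology, so the derivative below is the entrywise one.
attribute [local instance] Matrix.linftyOpNormedRing Matrix.linftyOpNormedAlgebra

/-- The product rule along the orbit gives the commutator `-i[X, ρ]`. -/
theorem deriv_unitary_orbit {S : Type*} [Fintype S] [DecidableEq S] (ρ X : Matrix S S ℂ) :
    deriv (fun s : ℝ => NormedSpace.exp (s • ((-Complex.I) • X)) * ρ *
      (NormedSpace.exp (s • ((-Complex.I) • X)))⁻¹) 0 = (-Complex.I) • (X * ρ - ρ * X) := by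
  have h1 := hasDerivAt_exp_smul_const (𝕂 := ℝ) ((-Complex.I) • X) (0 : ℝ)
  have h2 := hasDerivAt_exp_smul_const (𝕂 := ℝ) (-((-Complex.I) • X)) (0 : ℝ)
  have h := (h1.mul_const ρ).mul h2
  simp only [zero_smul, NormedSpace.exp_zero, one_mul, mul_one] at h
  have hf : (fun s : ℝ => NormedSpace.exp (s • ((-Complex.I) • X)) * ρ *
      (NormedSpace.exp (s • ((-Complex.I) • X)))⁻¹)
      = (fun s : ℝ => NormedSpace.exp (s • ((-Complex.I) • X)) * ρ) *
        fun s : ℝ => NormedSpace.exp (s • -((-Complex.I) • X)) := by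
    funext s
    simp only [Pi.mul_apply, ← Matrix.exp_neg, smul_neg]
  have hd : (-Complex.I) • (X * ρ - ρ * X)
      = (-Complex.I) • X * ρ + ρ * -((-Complex.I) • X) := by
    simp only [Matrix.smul_mul, Matrix.mul_smul, smul_add, smul_neg, mul_neg, sub_eq_add_neg]
  rw [hf, hd]
  exact h.deriv

end OrbitDerivative

theorem partialDeriv_unitaryFamily_zero {S : Type*} [Fintype S] [DecidableEq S] {N : ℕ}
    (ρ : Matrix S S ℂ) (X : Fin N → Matrix S S ℂ) (k : Fin N) :
    partialDeriv (fun t => unitaryFamily X t * ρ * (unitaryFamily X t)⁻¹) 0 k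
      = (-Complex.I) • (X k * ρ - ρ * X k) := by
  have hU : ∀ s : ℝ, unitaryFamily X (Function.update 0 k s)
      = NormedSpace.exp (s • ((-Complex.I) • X k)) := by
    intro s
    have hsum : ∑ j, ((Function.update (0 : Fin N → ℝ) k s j : ℝ) : ℂ) • X j
        = (s : ℂ) • X k := by
      rw [Finset.sum_eq_single k (fun j _ hj => by simp [hj]) (by simp)]
      simp
    rw [unitaryFamily, hsum, smul_comm, Complex.coe_smul]
  simp only [partialDeriv, hU]
  exact deriv_unitary_orbit ρ (X k)

/-- The Fisher information matrix in terms of an arbitrary choice of symmetric logarithmic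
derivatives. -/
theorem qFisherMatrix_apply {S : Type*} [Fintype S] [DecidableEq S] {N : ℕ}
    {ρ : Matrix S S ℂ} {X L : Fin N → Matrix S S ℂ}
    (hL : ∀ k, jordan ρ (L k) = (-Complex.I) • (X k * ρ - ρ * X k)) (k l : Fin N) :
    qFisherMatrix ρ X k l = (jordan ρ (L k) * L l).trace := by
  have h0 : unitaryFamily X 0 * ρ * (unitaryFamily X 0)⁻¹ = ρ := by simp [unitaryFamily]
  have hsld : jordan ρ (sld ρ (jordan ρ (L l))) = jordan ρ (L l) := by
    have h : ∃ K, jordan ρ K = jordan ρ (L l) := ⟨L l, rfl⟩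
    rw [sld, dif_pos h]
    exact h.choose_spec
  simp only [qFisherMatrix, fisherMatrix, Matrix.of_apply, partialDeriv_unitaryFamily_zero, h0,
    ← hL]
  exact trace_mul_eq_of_jordan_eq rfl hsld rfl

/-! ### Coefficient matrices of bipartite vectors -/

/-- The coefficient matrix of a vector of `ℂ^S ⊗ ℂ^R`. Under this identification the inner
product becomes `tr (Φᴴ Ψ)`, the operator `X ⊗ 1 + 1 ⊗ Y` becomes `Ψ ↦ X Ψ + Ψ Yᵀ`, and the
reduced state of `Ψ` becomes `Ψ Ψᴴ`. -/
def coeffMatrix {S R : Type*} (ψ : S × R → ℂ) : Matrix S R ℂ :=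
  Matrix.of fun i r => ψ (i, r)

theorem star_dotProduct_eq_trace {S R : Type*} [Fintype S] [Fintype R] (φ ψ : S × R → ℂ) :
    star φ ⬝ᵥ ψ = ((coeffMatrix φ)ᴴ * coeffMatrix ψ).trace := by
  simp only [dotProduct, Matrix.trace, Matrix.diag, Matrix.mul_apply, coeffMatrix,
    Matrix.conjTranspose_apply, Matrix.of_apply, Fintype.sum_prod_type, Pi.star_apply]
  exact Finset.sum_comm

theorem coeffMatrix_sumOp_mulVec {S R : Type*} [Fintype S] [DecidableEq S] [Fintype R]
    [DecidableEq R] (X : Matrix S S ℂ) (Y : Matrix R R ℂ) (ψ : S × R → ℂ) :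
    coeffMatrix (sumOp X Y *ᵥ ψ) = X * coeffMatrix ψ + coeffMatrix ψ * Yᵀ := by
  ext i r
  simp [coeffMatrix, sumOp, Matrix.mulVec, dotProduct, Matrix.mul_apply,
    Fintype.sum_prod_type, Matrix.one_apply, add_mul, Finset.sum_add_distrib, ite_mul, mul_comm]

theorem partialTrace_ketbra {S R : Type*} [Fintype R] (ψ : S × R → ℂ) :
    partialTrace (ketbra ψ) = coeffMatrix ψ * (coeffMatrix ψ)ᴴ := by
  ext i j
  simp [partialTrace, ketbra, coeffMatrix, Matrix.mul_apply, Matrix.vecMulVec_apply]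

theorem expect_ketbra {H : Type*} [Fintype H] (ψ : H → ℂ) (Y : Matrix H H ℂ) :
    expect (ketbra ψ) Y = star ψ ⬝ᵥ (Y *ᵥ ψ) := by
  rw [expect, ketbra, Matrix.trace_mul_comm, Matrix.mul_vecMulVec, Matrix.trace_vecMulVec,
    dotProduct_comm]

theorem star_expect_ketbra {H : Type*} [Fintype H] (ψ : H → ℂ) {Y : Matrix H H ℂ}
    (hY : Y.IsHermitian) : star (expect (ketbra ψ) Y) = expect (ketbra ψ) Y := by
  rw [expect_ketbra, ← Matrix.star_dotProduct, Matrix.star_mulVec, hY.eq,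
    Matrix.dotProduct_mulVec]

theorem isHermitian_centered {H : Type*} [Fintype H] [DecidableEq H] (ψ : H → ℂ)
    {Y : Matrix H H ℂ} (hY : Y.IsHermitian) : (centered (ketbra ψ) Y).IsHermitian := by
  rw [Matrix.IsHermitian, centered, Matrix.conjTranspose_sub, Matrix.conjTranspose_smul,
    star_expect_ketbra ψ hY, hY.eq, Matrix.conjTranspose_one]

theorem isHermitian_sumOp {S R : Type*} [DecidableEq S] [DecidableEq R]
    {X : Matrix S S ℂ} {Y : Matrix R R ℂ} (hX : X.IsHermitian) (hY : Y.IsHermitian) :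
    (sumOp X Y).IsHermitian := by
  simp [Matrix.IsHermitian, sumOp, Matrix.conjTranspose_kronecker, hX.eq, hY.eq]

/-! ### Covariance matrices as Gram matrices -/

/-- The symmetrized Gram matrix `Re tr (Bₖᴴ Bₗ)` of a family of coefficient matrices. -/
noncomputable def symGram {S R : Type*} [Fintype S] [Fintype R] {N : ℕ}
    (B : Fin N → Matrix S R ℂ) : Matrix (Fin N) (Fin N) ℂ :=
  Matrix.of fun k l => (1 / 2 : ℂ) * (((B k)ᴴ * B l).trace + ((B l)ᴴ * B k).trace)

theorem posSemidef_symGram {S R : Type*} [Fintype S] [Fintype R] {N : ℕ}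
    (B : Fin N → Matrix S R ℂ) : (symGram B).PosSemidef := by
  set M : Matrix (R × S) (Fin N) ℂ := Matrix.of fun x k => B k x.2 x.1
  have hM := Matrix.posSemidef_conjTranspose_mul_self M
  have h : symGram B = (1 / 2 : ℂ) • (Mᴴ * M + (Mᴴ * M)ᵀ) := by
    ext k l
    simp [symGram, M, Matrix.trace, Matrix.mul_apply, Fintype.sum_prod_type,
      mul_comm]
  rw [h]
  exact (hM.add hM.transpose).smul (by norm_num [Complex.le_def])

/-- The coefficient matrix of the vector `(X ⊗ 1 + 1 ⊗ Y - ⟨X ⊗ 1 + 1 ⊗ Y⟩) |ψ⟩`. -/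
noncomputable def deviation {S R : Type*} [Fintype S] [DecidableEq S] [Fintype R] [DecidableEq R]
    (ψ : S × R → ℂ) (X : Matrix S S ℂ) (Y : Matrix R R ℂ) : Matrix S R ℂ :=
  X * coeffMatrix ψ + coeffMatrix ψ * Yᵀ - expect (ketbra ψ) (sumOp X Y) • coeffMatrix ψ

theorem coeffMatrix_centered_mulVec {S R : Type*} [Fintype S] [DecidableEq S] [Fintype R]
    [DecidableEq R] (X : Matrix S S ℂ) (Y : Matrix R R ℂ) (ψ : S × R → ℂ) :
    coeffMatrix (centered (ketbra ψ) (sumOp X Y) *ᵥ ψ) = deviation ψ X Y := by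
  rw [deviation, ← coeffMatrix_sumOp_mulVec, centered, Matrix.sub_mulVec, Matrix.smul_mulVec,
    Matrix.one_mulVec]
  rfl

theorem covMatrix_ketbra_sumOp {S R : Type*} [Fintype S] [DecidableEq S] [Fintype R]
    [DecidableEq R] {N : ℕ} (ψ : S × R → ℂ) {X : Fin N → Matrix S S ℂ}
    {Y : Fin N → Matrix R R ℂ} (hX : ∀ n, (X n).IsHermitian) (hY : ∀ n, (Y n).IsHermitian) :
    covMatrix (ketbra ψ) (fun n => sumOp (X n) (Y n))
      = symGram fun n => deviation ψ (X n) (Y n) := by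
  have key : ∀ k l, expect (ketbra ψ) (centered (ketbra ψ) (sumOp (X k) (Y k)) *
      centered (ketbra ψ) (sumOp (X l) (Y l)))
      = ((deviation ψ (X k) (Y k))ᴴ * deviation ψ (X l) (Y l)).trace := by
    intro k l
    rw [expect_ketbra, ← coeffMatrix_centered_mulVec, ← coeffMatrix_centered_mulVec,
      ← star_dotProduct_eq_trace, Matrix.star_mulVec,
      (isHermitian_centered ψ (isHermitian_sumOp (hX k) (hY k))).eq, ← Matrix.dotProduct_mulVec,
      Matrix.mulVec_mulVec]
  ext k l
  rw [covMatrix, symGram, Matrix.of_apply, Matrix.of_apply, ← key, ← key]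
  simp only [expect, Matrix.mul_add, Matrix.trace_add]

/-! ### The lower bound -/

/-- The tangent vector `-i[X, ρ]` of the reduced orbit does not see the generator `Y` of the
auxiliary system, nor the mean value. -/
theorem deviation_mul_conjTranspose_sub {S R : Type*} [Fintype S] [DecidableEq S] [Fintype R]
    [DecidableEq R] {ρ : Matrix S S ℂ} {ψ : S × R → ℂ} (hψ : IsPurification ρ ψ)
    {X : Matrix S S ℂ} {Y : Matrix R R ℂ} (hX : X.IsHermitian) (hY : Y.IsHermitian) :
    deviation ψ X Y * (coeffMatrix ψ)ᴴ - coeffMatrix ψ * (deviation ψ X Y)ᴴ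
      = X * ρ - ρ * X := by
  have hYt : Yᵀᴴ = Yᵀ := hY.transpose.eq
  rw [IsPurification, partialTrace_ketbra] at hψ
  simp only [deviation, Matrix.conjTranspose_sub, Matrix.conjTranspose_add,
    Matrix.conjTranspose_mul, Matrix.conjTranspose_smul,
    star_expect_ketbra ψ (isHermitian_sumOp hX hY), hX.eq, hYt, Matrix.sub_mul, Matrix.mul_sub,
    Matrix.add_mul, Matrix.mul_add, Matrix.smul_mul, Matrix.mul_smul, Matrix.mul_assoc, hψ]
  rw [← Matrix.mul_assoc (coeffMatrix ψ) (coeffMatrix ψ)ᴴ X, hψ]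
  abel

/-- Completing the square: the covariance matrix exceeds a quarter of the Fisher information
matrix by the symmetrized Gram matrix of `(Xₖ + Yₖ - ⟨Xₖ + Yₖ⟩)|ψ⟩ - (i/2) Lₖ|ψ⟩`. -/
theorem covMatrix_eq_add_symGram {S R : Type*} [Fintype S] [DecidableEq S] [Fintype R]
    [DecidableEq R] {N : ℕ} {ρ : Matrix S S ℂ} {ψ : S × R → ℂ} (hψ : IsPurification ρ ψ)
    {X L : Fin N → Matrix S S ℂ} {Y : Fin N → Matrix R R ℂ}
    (hX : ∀ n, (X n).IsHermitian) (hY : ∀ n, (Y n).IsHermitian) (hL : ∀ n, (L n).IsHermitian)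
    (hXL : ∀ k, jordan ρ (L k) = (-Complex.I) • (X k * ρ - ρ * X k)) :
    covMatrix (ketbra ψ) (fun n => sumOp (X n) (Y n))
      = (1 / 4 : ℂ) • qFisherMatrix ρ X
        + symGram fun n => deviation ψ (X n) (Y n) - (Complex.I / 2) • (L n * coeffMatrix ψ) := by
  rw [covMatrix_ketbra_sumOp ψ hX hY]
  set Ψ := coeffMatrix ψ
  set A : Fin N → Matrix S R ℂ := fun n => deviation ψ (X n) (Y n)
  have hρ : Ψ * Ψᴴ = ρ := by rw [← partialTrace_ketbra]; exact hψ
  have cross : ∀ k l, ((A k)ᴴ * (L l * Ψ)).trace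
      = (L l * (A k * Ψᴴ)).trace - Complex.I * (jordan ρ (L k) * L l).trace := by
    intro k l
    have e1 : ((A k)ᴴ * (L l * Ψ)).trace = (L l * (Ψ * (A k)ᴴ)).trace := by
      rw [Matrix.trace_mul_comm, Matrix.mul_assoc]
    have e2 : jordan ρ (L k) = (-Complex.I) • (A k * Ψᴴ - Ψ * (A k)ᴴ) := by
      rw [hXL, deviation_mul_conjTranspose_sub hψ (hX k) (hY k)]
    rw [e1, e2, Matrix.trace_mul_comm _ (L l), Matrix.mul_smul, Matrix.mul_sub,
      Matrix.trace_smul, Matrix.trace_sub, smul_eq_mul]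
    linear_combination ((L l * (Ψ * (A k)ᴴ)).trace - (L l * (A k * Ψᴴ)).trace) * Complex.I_sq
  have cross' : ∀ k l, (Ψᴴ * (L k * A l)).trace = (L k * (A l * Ψᴴ)).trace := by
    intro k l
    rw [Matrix.trace_mul_comm, Matrix.mul_assoc]
  have quad : ∀ k l, (Ψᴴ * (L k * (L l * Ψ))).trace = (ρ * (L k * L l)).trace := by
    intro k l
    rw [← hρ, Matrix.trace_mul_comm, Matrix.trace_mul_comm (Ψ * Ψᴴ)]
    simp only [Matrix.mul_assoc]
  have fisher : ∀ k l, (jordan ρ (L k) * L l).trace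
      = 1 / 2 * ((ρ * (L k * L l)).trace + (ρ * (L l * L k)).trace) := by
    intro k l
    rw [jordan, Matrix.smul_mul, Matrix.trace_smul, Matrix.add_mul, Matrix.trace_add,
      Matrix.mul_assoc, Matrix.mul_assoc, Matrix.trace_mul_comm (L k), Matrix.mul_assoc,
      smul_eq_mul]
  ext k l
  rw [Matrix.add_apply, Matrix.smul_apply, qFisherMatrix_apply hXL, symGram, symGram,
    Matrix.of_apply, Matrix.of_apply]
  change 1 / 2 * (((A k)ᴴ * A l).trace + ((A l)ᴴ * A k).trace) = _ + 1 / 2 *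
    (((A k - (Complex.I / 2) • (L k * Ψ))ᴴ * (A l - (Complex.I / 2) • (L l * Ψ))).trace
    + ((A l - (Complex.I / 2) • (L l * Ψ))ᴴ * (A k - (Complex.I / 2) • (L k * Ψ))).trace)
  have hI : star (Complex.I / 2) = -(Complex.I / 2) := by simp [neg_div]
  simp only [Matrix.conjTranspose_sub, Matrix.conjTranspose_smul, Matrix.conjTranspose_mul,
    (hL _).eq, Matrix.sub_mul, Matrix.mul_sub, Matrix.smul_mul, Matrix.mul_smul,
    Matrix.trace_sub, Matrix.trace_smul, Matrix.mul_assoc, cross, cross', quad, fisher, hI,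
    smul_eq_mul]
  ring_nf
  simp only [Complex.I_sq]
  ring

/-! ### Attaining the bound -/

/-- A square root `Ψ` of the state for which every `X` has a Hermitian symmetric logarithmic
derivative `L` and a Hermitian partner `Z` with `X Ψ + Ψ Z = (i/2) L Ψ`. In an eigenbasis of `ρ`
with eigenvalues `pᵢ`, the entries of `L` are `-2i Xᵢⱼ (pⱼ - pᵢ) / (pᵢ + pⱼ)`. The columns of
`Ψ` are `√pⱼ` times the eigenvectors, and `Z` is `-2 Xᵢⱼ √(pᵢ pⱼ) / (pᵢ + pⱼ)`. -/
theorem exists_optimal_square_root {S : Type*} [Fintype S] [DecidableEq S] {ρ : Matrix S S ℂ}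
    (hρ : ρ.PosSemidef) :
    ∃ Ψ : Matrix S S ℂ, Ψ * Ψᴴ = ρ ∧ ∀ X : Matrix S S ℂ, X.IsHermitian →
      ∃ L Z : Matrix S S ℂ, L.IsHermitian ∧ Z.IsHermitian ∧
        jordan ρ L = (-Complex.I) • (X * ρ - ρ * X) ∧
        X * Ψ + Ψ * Z = (Complex.I / 2) • (L * Ψ) := by
  obtain ⟨U, p, h1, h2, hs, hp0⟩ : ∃ (U : Matrix S S ℂ) (p : S → ℝ), Uᴴ * U = 1 ∧
      U * Uᴴ = 1 ∧ ρ = U * Matrix.diagonal (fun i => (p i : ℂ)) * Uᴴ ∧ ∀ i, 0 ≤ p i :=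
    ⟨_, _, Unitary.coe_star_mul_self hρ.1.eigenvectorUnitary,
      Unitary.coe_mul_star_self hρ.1.eigenvectorUnitary,
      by simpa [Unitary.conjStarAlgAut_apply, Function.comp_def, Matrix.star_eq_conjTranspose] using hρ.1.spectral_theorem,
      hρ.eigenvalues_nonneg⟩
  set P : Matrix S S ℂ := Matrix.diagonal fun i => (p i : ℂ) with hP
  set Q : Matrix S S ℂ := Matrix.diagonal fun i => (√(p i) : ℂ) with hQ
  have hq : ∀ i, (√(p i) : ℂ) * √(p i) = p i := fun i => by
    exact_mod_cast Real.mul_self_sqrt (hp0 i)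
  have hQh : Qᴴ = Q := by
    ext i j
    by_cases h : i = j
    · subst h; simp [hQ]
    · simp [hQ, h, Ne.symm h]
  have hQQ : Q * Q = P := by simp [hQ, hP, Matrix.diagonal_mul_diagonal, hq]
  have cancel : ∀ M : Matrix S S ℂ, Uᴴ * (U * M) = M := fun M => by
    rw [← Matrix.mul_assoc, h1, Matrix.one_mul]
  have cancel' : ∀ M : Matrix S S ℂ, U * (Uᴴ * M) = M := fun M => by
    rw [← Matrix.mul_assoc, h2, Matrix.one_mul]
  have hzero : ∀ i j, (p i : ℂ) + p j = 0 → p i = 0 ∧ p j = 0 := by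
    intro i j h
    have h' : p i + p j = 0 := by exact_mod_cast h
    constructor <;> linarith [hp0 i, hp0 j]
  refine ⟨U * Q, ?_, fun X hX => ?_⟩
  · rw [Matrix.conjTranspose_mul, hQh, hs, ← hQQ]
    simp only [Matrix.mul_assoc]
  set W : Matrix S S ℂ := Uᴴ * X * U with hW
  have hWh : Wᴴ = W := by simp [hW, hX.eq, Matrix.mul_assoc]
  have hWe : ∀ i j, star (W i j) = W j i := fun i j => by
    rw [← Matrix.conjTranspose_apply, hWh]
  have hXW : X = U * W * Uᴴ := by
    simp only [hW, Matrix.mul_assoc, cancel', h2, Matrix.mul_one]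
  set M : Matrix S S ℂ := Matrix.of fun i j =>
    2 * (-Complex.I) * W i j * ((p j : ℂ) - p i) / ((p i : ℂ) + p j) with hM
  set Z : Matrix S S ℂ := Matrix.of fun i j =>
    -2 * W i j * (√(p i) * √(p j)) / ((p i : ℂ) + p j) with hZ
  have hMh : Mᴴ = M := by
    ext i j
    have := hWe j i
    simp only [Complex.star_def] at this
    simp only [hM, Matrix.conjTranspose_apply, Matrix.of_apply, Complex.star_def, map_div₀,
      map_mul, map_sub, map_add, map_neg, Complex.conj_I, Complex.conj_ofReal, this, map_ofNat]
    rw [add_comm (p j : ℂ)]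
    ring
  have hZh : Zᴴ = Z := by
    ext i j
    have := hWe j i
    simp only [Complex.star_def] at this
    simp only [hZ, Matrix.conjTranspose_apply, Matrix.of_apply, Complex.star_def, map_div₀,
      map_mul, map_add, map_neg, Complex.conj_ofReal, this, map_ofNat]
    rw [add_comm (p j : ℂ)]
    ring
  have hJ : jordan P M = (-Complex.I) • (W * P - P * W) := by
    ext i j
    simp only [jordan, hP, hM, Matrix.smul_apply, Matrix.add_apply, Matrix.sub_apply,
      Matrix.diagonal_mul, Matrix.mul_diagonal, Matrix.of_apply, smul_eq_mul]
    -- If `pᵢ + pⱼ = 0`, then `Mᵢⱼ` is `x / 0 = 0`, and all terms vanish with `pᵢ = pⱼ = 0`.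
    by_cases h : (p i : ℂ) + p j = 0
    · simp [hzero i j h]
    · field_simp
      ring
  have hopt : W * Q + Q * Z = (Complex.I / 2) • (M * Q) := by
    ext i j
    simp only [hQ, hM, hZ, Matrix.smul_apply, Matrix.add_apply,
      Matrix.diagonal_mul, Matrix.mul_diagonal, Matrix.of_apply, smul_eq_mul]
    by_cases h : (p i : ℂ) + p j = 0
    · simp [hzero i j h]
    · field_simp
      linear_combination (-2 * W i j * √(p j)) * hq i
        + W i j * √(p j) * ((p j : ℂ) - p i) * Complex.I_sq
  refine ⟨U * M * Uᴴ, Z, ?_, hZh, ?_, ?_⟩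
  · simp [Matrix.IsHermitian, Matrix.conjTranspose_mul, hMh, Matrix.mul_assoc]
  · have e : jordan ρ (U * M * Uᴴ) = U * jordan P M * Uᴴ := by
      simp only [hs, jordan, Matrix.mul_smul, Matrix.smul_mul, Matrix.mul_add, Matrix.add_mul,
        Matrix.mul_assoc, cancel]
    rw [e, hJ, hs, hXW]
    simp only [Matrix.mul_smul, Matrix.smul_mul, Matrix.mul_sub, Matrix.sub_mul,
      Matrix.mul_assoc, cancel]
  · have e := congrArg (U * ·) hopt
    simp only [Matrix.mul_add, Matrix.mul_smul] at e
    rw [hXW]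
    simp only [Matrix.mul_assoc, cancel]
    exact e

/-- A purification with auxiliary operators that saturate the bound: the deviation vectors of
`Xₙ + Yₙ` are `(i/2) Lₙ|ψ⟩`. -/
theorem exists_optimal_purification {S : Type*} [Fintype S] [DecidableEq S] {N : ℕ}
    {ρ : Matrix S S ℂ} (hρ : ρ.PosSemidef)
    {X : Fin N → Matrix S S ℂ} (hX : ∀ n, (X n).IsHermitian) :
    ∃ (m : ℕ) (ψ : S × Fin m → ℂ) (Y : Fin N → Matrix (Fin m) (Fin m) ℂ)
      (L : Fin N → Matrix S S ℂ), IsPurification ρ ψ ∧ (∀ n, (Y n).IsHermitian) ∧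
        (∀ n, (L n).IsHermitian) ∧
        (∀ n, jordan ρ (L n) = (-Complex.I) • (X n * ρ - ρ * X n)) ∧
        ∀ n, deviation ψ (X n) (Y n) = (Complex.I / 2) • (L n * coeffMatrix ψ) := by
  obtain ⟨Ψ, hΨ, hopt⟩ := exists_optimal_square_root hρ
  choose L Z hL hZ hXL hLZ using fun n => hopt (X n) (hX n)
  set e := (Fintype.equivFin S).symm
  set ψ : S × Fin (Fintype.card S) → ℂ := fun x => Ψ x.1 (e x.2)
  have hc : coeffMatrix ψ = Ψ.submatrix id e := rfl
  have hpur : coeffMatrix ψ * (coeffMatrix ψ)ᴴ = ρ := by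
    rw [hc, Matrix.conjTranspose_submatrix, Matrix.submatrix_mul_equiv, hΨ, Matrix.submatrix_id_id]
  have hsum : ∀ n, X n * coeffMatrix ψ + coeffMatrix ψ * (((Z n).submatrix e e)ᵀ)ᵀ
      = (Complex.I / 2) • (L n * coeffMatrix ψ) := by
    intro n
    have h := congrArg (fun M => M.submatrix id e) (hLZ n)
    rw [Matrix.transpose_transpose, hc, Matrix.submatrix_mul_equiv]
    exact h
  refine ⟨_, ψ, fun n => ((Z n).submatrix e e)ᵀ, L, ?_, fun n => ((hZ n).submatrix e).transpose,
    hL, hXL, fun n => ?_⟩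
  · rw [IsPurification, partialTrace_ketbra, hpur]
  -- The mean value is `(i/2) tr (ρ Lₙ)`, half of `i` times the trace of a commutator.
  have htr : (ρ * L n).trace = 0 := by
    have h := congrArg Matrix.trace (hXL n)
    rw [jordan, Matrix.trace_smul, Matrix.trace_smul, Matrix.trace_sub, Matrix.trace_add,
      Matrix.trace_mul_comm (L n), Matrix.trace_mul_comm (X n), sub_self, smul_zero,
      smul_eq_mul] at h
    linear_combination h
  have hmean : expect (ketbra ψ) (sumOp (X n) ((Z n).submatrix e e)ᵀ) = 0 := by
    rw [expect_ketbra, star_dotProduct_eq_trace, coeffMatrix_sumOp_mulVec, hsum, Matrix.mul_smul,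
      Matrix.trace_smul, Matrix.trace_mul_comm, Matrix.mul_assoc, hpur, Matrix.trace_mul_comm,
      htr, smul_zero]
  rw [deviation, hmean, zero_smul, sub_zero, hsum]

end QuantumFisher

theorem mainTheorem5 {S : Type*} [Fintype S] [DecidableEq S] {N : ℕ}
    (ρ : Matrix S S ℂ) (hρ : QuantumFisher.IsState ρ)
    (XS : Fin N → Matrix S S ℂ) (hXS : ∀ n, (XS n).IsHermitian) :
    ∃ V : Matrix (Fin N) (Fin N) ℂ,
      IsLeast (QuantumFisher.purifiedCovMatrices ρ XS) V ∧
        QuantumFisher.qFisherMatrix ρ XS = (4 : ℂ) • V := by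
  obtain ⟨m, ψ, Y, L, hψ, hY, hL, hXL, hdev⟩ :=
    QuantumFisher.exists_optimal_purification hρ.posSemidef hXS
  refine ⟨(1 / 4 : ℂ) • QuantumFisher.qFisherMatrix ρ XS, ⟨⟨m, ψ, Y, hψ, hY, ?_⟩, ?_⟩, ?_⟩
  · rw [QuantumFisher.covMatrix_eq_add_symGram hψ hXS hY hL hXL]
    ext k l
    simp [hdev, QuantumFisher.symGram]
  · rintro _ ⟨m', φ, Y', hφ, hY', rfl⟩
    rw [QuantumFisher.covMatrix_eq_add_symGram hφ hXS hY' hL hXL]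
    exact le_add_of_nonneg_right (QuantumFisher.posSemidef_symGram _).nonneg
  · rw [smul_smul]
    norm_num
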